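/- Let $R$ be a commutative ring with unit, $I$ an ideal of $R$, and $E$ an injective cogenerator of the category of $R$-modules. For an $R$-module $M$ put $$\Gamma_I(M)=\varinjlim_k \operatorname{Hom}_R(R/I^k,M),\qquad \Lambda_I(M)=\varprojlim_k M/I^kM ,$$ and call $M$ $I$-reduced if $\Gamma_I(M)\cong\operatorname{Hom}_R(R/I,M)$, and $I$-coreduced if $\Lambda_I(M)\cong R/I\otimes_R M$. Evaluation at $1$ embeds $\Gamma_I(M)$ canonically in $M$. Consider the classes of $R$-modules $$\mathfrak T_I=\{N \text{ $I$-coreduced}: IN=N\},\quad T_I=\{N \text{ $I$-reduced}: \Gamma_I(N)=N\},\quad \mathcal F_I=\{N \text{ $I$-reduced}: \Gamma_I(N)=0\},$$ where $\Gamma_I(N)=N$ means that the canonical embedding $\Gamma_I(N)\to N$ is an isomorphism. Let $M$ be an $R$-module that is both $I$-reduced and $I$-coreduced. Then: 1. $M\in T_I$ if and only if $\operatorname{Hom}_R(M,E)\in T_I$; 2. if in addition $I$ is finitely generated, then $M\in\mathcal F_I$ if and only if $\operatorname{Hom}_R(M,E)\in\mathfrak T_I$; 3. $M\in\mathfrak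 T_I$ if and only if $\operatorname{Hom}_R(M,E)\in\mathcal F_I$. -/

import Mathlib

open scoped TensorProduct

universe u v

noncomputable section

namespace ITorsion

variable {R : Type u} [CommRing R] (I : Ideal R) (M : Type v) [AddCommGroup M] [Module R M]

/-- The transition map `Hom_R(R/I^i, M) → Hom_R(R/I^j, M)` for `i ≤ j`, given by precomposition
with the projection `R/I^j → R/I^i`. -/
def transition (i j : ℕ) (h : i ≤ j) :
    ((R ⧸ I ^ i) →ₗ[R] M) →ₗ[R] ((R ⧸ I ^ j) →ₗ[R] M) :=
  LinearMap.lcomp R M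
    (Ideal.Quotient.factorₐ R (Ideal.pow_le_pow_right h : I ^ j ≤ I ^ i)).toLinearMap

/-- `Γ_I(M)`, the direct limit of the modules `Hom_R(R/I^k, M)`. -/
abbrev Gamma : Type (max u v) :=
  Module.DirectLimit (fun k : ℕ => (R ⧸ I ^ k) →ₗ[R] M) (transition I M)

/-- The canonical embedding `Γ_I(M) → M`, induced by the evaluations `f ↦ f 1` on
`Hom_R(R/I^k, M)`. -/
def Gamma.toModule : Gamma I M →ₗ[R] M :=
  Module.DirectLimit.lift R ℕ (fun k : ℕ => (R ⧸ I ^ k) →ₗ[R] M) (transition I M)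
    (fun k => LinearMap.applyₗ (1 : R ⧸ I ^ k))
    (fun i j h f => by simp [transition])

/-- `Λ_I(M)`, the inverse limit of the modules `M/I^k M`. -/
abbrev Lambda : Type v := AdicCompletion I M

/-- `M` is `I`-reduced: `Γ_I(M) ≅ Hom_R(R/I, M)`. -/
def IsIReduced : Prop := Nonempty (Gamma I M ≃ₗ[R] ((R ⧸ I) →ₗ[R] M))

/-- `M` is `I`-coreduced: `Λ_I(M) ≅ R/I ⊗ M`. -/
def IsICoreduced : Prop := Nonempty (Lambda I M ≃ₗ[R] ((R ⧸ I) ⊗[R] M))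

/-- The middle class `T_I`: the `I`-reduced modules with `Γ_I(M) = M`. -/
def MemT : Prop := IsIReduced I M ∧ Function.Bijective (Gamma.toModule I M)

/-- The torsion-free class `ℱ_I`: the `I`-reduced modules with `Γ_I(M) = 0`. -/
def MemF : Prop := IsIReduced I M ∧ Subsingleton (Gamma I M)

/-- The torsion class `𝔗_I`: the `I`-coreduced modules with `IM = M`. -/
def MemFrakT : Prop := IsICoreduced I M ∧ I • (⊤ : Submodule R M) = ⊤

end ITorsion

end

namespace ITorsion

variable {R : Type u} [CommRing R] (I : Ideal R) (M : Type v) [AddCommGroup M] [Module R M]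

/-! Each class has an elementary description: `T_I` means `IM = 0`, `ℱ_I` that no nonzero element is
killed by `I`, `𝔗_I` that `IM = M` (`memT_iff`, `memF_iff`, `memFrakT_iff`). These conditions are
then compared across `Hom(-, E)`. Maps to `E` separate points (`eq_zero_of_forall_hom_eq_zero`);
injectivity of `E` and finite generation of `I` enter only in `smul_top_dual_eq_top`. -/

variable {I M} in
/-- The map `R/J → M` sending `1` to an element annihilated by `J`. -/
def homOfAnnihilated (J : Ideal R) (m : M) (h : ∀ a ∈ J, a • m = 0) : (R ⧸ J) →ₗ[R] M :=
  Submodule.liftQ J (LinearMap.toSpanSingleton R M m) (fun a ha => by simpa using h a ha)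

variable {I M} in
theorem homOfAnnihilated_one (J : Ideal R) (m : M) (h : ∀ a ∈ J, a • m = 0) :
    homOfAnnihilated J m h 1 = m := by
  change Submodule.liftQ J (LinearMap.toSpanSingleton R M m) _ (Submodule.Quotient.mk (1 : R)) = m
  rw [Submodule.liftQ_apply]
  simp

variable {M} in
theorem hom_quotient_ext {J : Ideal R} {f g : (R ⧸ J) →ₗ[R] M} (h : f 1 = g 1) : f = g := by
  ext
  simpa using h

variable {M} in
theorem smul_quotient_one {J : Ideal R} {a : R} (ha : a ∈ J) : a • (1 : R ⧸ J) = 0 := by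
  rw [Algebra.smul_def, mul_one]
  exact Ideal.Quotient.eq_zero_iff_mem.2 ha

variable {M} in
theorem smul_hom_quotient {J : Ideal R} {a : R} (ha : a ∈ J) (f : (R ⧸ J) →ₗ[R] M) :
    a • f = 0 := by
  apply hom_quotient_ext
  rw [LinearMap.smul_apply, ← map_smul, smul_quotient_one ha, map_zero, LinearMap.zero_apply]

theorem Gamma.toModule_of (k : ℕ) (f : (R ⧸ I ^ k) →ₗ[R] M) :
    Gamma.toModule I M (Module.DirectLimit.of R ℕ _ (transition I M) k f) = f 1 := by
  simp [Gamma.toModule]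

theorem Gamma.toModule_injective : Function.Injective (Gamma.toModule I M) := by
  rw [injective_iff_map_eq_zero]
  intro x hx
  obtain ⟨k, f, rfl⟩ := Module.DirectLimit.exists_of x
  rw [Gamma.toModule_of] at hx
  rw [show f = 0 from hom_quotient_ext (by simpa using hx), map_zero]

variable {M} in
theorem Gamma.exists_toModule_eq (k : ℕ) (m : M) (h : ∀ a ∈ I ^ k, a • m = 0) :
    ∃ x, Gamma.toModule I M x = m :=
  ⟨Module.DirectLimit.of R ℕ _ (transition I M) k (homOfAnnihilated _ m h), by
    rw [Gamma.toModule_of, homOfAnnihilated_one]⟩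

theorem memT_iff : MemT I M ↔ ∀ a ∈ I, ∀ m : M, a • m = 0 := by
  constructor
  · rintro ⟨⟨e⟩, hb⟩ a ha m
    obtain ⟨x, rfl⟩ := hb.2 m
    -- Any isomorphism, canonical or not, transports annihilation by `I` from `Hom(R/I, M)` to
    -- `Γ_I(M)`.
    have : a • x = 0 := e.injective (by rw [map_smul, smul_hom_quotient ha, map_zero])
    rw [← map_smul, this, map_zero]
  · intro h
    have hb : Function.Bijective (Gamma.toModule I M) :=
      ⟨Gamma.toModule_injective I M, fun m => Gamma.exists_toModule_eq I 1 m
        (fun a ha => h a (by simpa using ha) m)⟩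
    have hb' : Function.Bijective
        (LinearMap.applyₗ (1 : R ⧸ I) : ((R ⧸ I) →ₗ[R] M) →ₗ[R] M) :=
      ⟨fun f g hfg => hom_quotient_ext hfg, fun m =>
        ⟨homOfAnnihilated I m (fun a ha => h a ha m), homOfAnnihilated_one I m fun a ha => h a ha m⟩⟩
    exact ⟨⟨(LinearEquiv.ofBijective _ hb).trans (LinearEquiv.ofBijective _ hb').symm⟩, hb⟩

-- If `I^(k+1)` kills `m`, then `I^k` kills each `a • m` with `a ∈ I`, so induction gives `I m = 0`.
variable {M} in
theorem eq_zero_of_pow_annihilated (h : ∀ m : M, (∀ a ∈ I, a • m = 0) → m = 0) (k : ℕ) :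
    ∀ m : M, (∀ a ∈ I ^ k, a • m = 0) → m = 0 := by
  induction k with
  | zero => exact fun m hm => by simpa using hm 1 (by simp)
  | succ k ih =>
    refine fun m hm => h m fun a ha => ih _ fun b hb => ?_
    rw [← mul_smul]
    exact hm _ (by rw [pow_succ]; exact Ideal.mul_mem_mul hb ha)

theorem memF_iff : MemF I M ↔ ∀ m : M, (∀ a ∈ I, a • m = 0) → m = 0 := by
  constructor
  · rintro ⟨-, hs⟩ m hm
    obtain ⟨x, rfl⟩ := Gamma.exists_toModule_eq I 1 m (by simpa using hm)
    rw [Subsingleton.elim x 0, map_zero]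
  · intro h
    have hs : Subsingleton (Gamma I M) := by
      refine subsingleton_of_forall_eq 0 fun x => ?_
      obtain ⟨k, f, rfl⟩ := Module.DirectLimit.exists_of x
      have : f 1 = 0 := eq_zero_of_pow_annihilated I h k _ fun a ha => by
        rw [← map_smul, smul_quotient_one ha, map_zero]
      rw [show f = 0 from hom_quotient_ext (by simpa using this), map_zero]
    have hs' : Subsingleton ((R ⧸ I) →ₗ[R] M) := by
      refine subsingleton_of_forall_eq 0 fun f => hom_quotient_ext (h _ fun a ha => ?_)
      rw [← map_smul, smul_quotient_one ha, map_zero]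
    -- Both modules vanish, so the zero map is an equivalence.
    exact ⟨⟨0⟩, hs⟩

/-- `IM = M` forces `I^k M = M` for all `k`, so `Λ_I(M)` and `R/I ⊗ M` are both zero. -/
theorem memFrakT_iff : MemFrakT I M ↔ I • (⊤ : Submodule R M) = ⊤ := by
  refine ⟨And.right, fun h => ⟨?_, h⟩⟩
  have hpow (k : ℕ) : I ^ k • (⊤ : Submodule R M) = ⊤ := by
    induction k with
    | zero => simp
    | succ k ih => rw [pow_succ, Submodule.mul_smul, h, ih]
  have hs : Subsingleton (Lambda I M) := by
    refine subsingleton_of_forall_eq 0 fun x => AdicCompletion.ext fun k => ?_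
    have : Subsingleton (M ⧸ (I ^ k • (⊤ : Submodule R M))) :=
      Submodule.Quotient.subsingleton_iff.2 (hpow k)
    exact Subsingleton.elim _ _
  have : Subsingleton (M ⧸ (I • (⊤ : Submodule R M))) :=
    Submodule.Quotient.subsingleton_iff.2 h
  have hs' : Subsingleton ((R ⧸ I) ⊗[R] M) :=
    (TensorProduct.quotTensorEquivQuotSMul M I).toEquiv.subsingleton
  exact ⟨0⟩

section Duality

variable {E : Type v} [AddCommGroup E] [Module R E]

-- The cogenerator property is applied to the inclusion of `Rm` in `M`.
variable {M} in
theorem eq_zero_of_forall_hom_eq_zero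
    (hE : CategoryTheory.IsCoseparator (ModuleCat.of R E)) (m : M)
    (h : ∀ f : M →ₗ[R] E, f m = 0) : m = 0 := by
  have key : ModuleCat.ofHom (Submodule.span R {m}).subtype = 0 := by
    refine (CategoryTheory.isCoseparator_def _).1 hE _ _ fun g => ?_
    ext ⟨x, hx⟩
    obtain ⟨r, rfl⟩ := Submodule.mem_span_singleton.1 hx
    have := h g.hom
    simp [this]
  have := congrArg (fun g => g.hom ⟨m, Submodule.mem_span_singleton_self m⟩) key
  simpa using this

theorem memT_dual_iff (hE : CategoryTheory.IsCoseparator (ModuleCat.of R E)) :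
    MemT I M ↔ MemT I (M →ₗ[R] E) := by
  rw [memT_iff, memT_iff]
  constructor
  · intro h a ha f
    ext m
    rw [LinearMap.smul_apply, ← map_smul, h a ha, map_zero, LinearMap.zero_apply]
  · intro h a ha m
    refine eq_zero_of_forall_hom_eq_zero hE _ fun f => ?_
    rw [map_smul, ← LinearMap.smul_apply, h a ha, LinearMap.zero_apply]

theorem memFrakT_iff_memF_dual (hE : CategoryTheory.IsCoseparator (ModuleCat.of R E)) :
    MemFrakT I M ↔ MemF I (M →ₗ[R] E) := by
  rw [memFrakT_iff, memF_iff]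
  constructor
  · intro h f hf
    have : (⊤ : Submodule R M) ≤ LinearMap.ker f := by
      rw [← h, Submodule.smul_le]
      intro a ha m _
      rw [LinearMap.mem_ker, map_smul, ← LinearMap.smul_apply, hf a ha, LinearMap.zero_apply]
    exact LinearMap.ker_eq_top.1 (top_le_iff.1 this)
  · intro h
    refine Submodule.eq_top_iff'.2 fun m => ?_
    rw [← Submodule.Quotient.mk_eq_zero]
    -- A map `M/IM → E` pulls back to a map on `M` killed by `I`, hence zero.
    refine eq_zero_of_forall_hom_eq_zero hE _ fun g => ?_
    have : g ∘ₗ (I • (⊤ : Submodule R M)).mkQ = 0 := h _ fun a ha => by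
      ext x
      have hx : (I • (⊤ : Submodule R M)).mkQ (a • x) = 0 :=
        (Submodule.Quotient.mk_eq_zero _).2 (Submodule.smul_mem_smul ha Submodule.mem_top)
      rw [LinearMap.smul_apply, ← map_smul, LinearMap.comp_apply, hx, map_zero,
        LinearMap.zero_apply]
    exact LinearMap.congr_fun this m

-- Generators `s i` of `I` give an embedding `m ↦ (s i • m)` of `M` in `M^n`. Extending `f` along it
-- to `g : M^n → E` yields `f = ∑ s i • g_i`, with `g_i` the components of `g`.
variable {I M} in
theorem smul_top_dual_eq_top (hE : Module.Injective R E) (hI : I.FG)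
    (h : ∀ m : M, (∀ a ∈ I, a • m = 0) → m = 0) :
    I • (⊤ : Submodule R (M →ₗ[R] E)) = ⊤ := by
  obtain ⟨n, s, rfl⟩ := Submodule.fg_iff_exists_fin_generating_family.1 hI
  let φ : M →ₗ[R] (Fin n → M) := LinearMap.pi fun i => LinearMap.lsmul R M (s i)
  have hφ : Function.Injective φ := by
    rw [injective_iff_map_eq_zero]
    refine fun m hm => h m fun a ha => ?_
    have hle : Ideal.span (Set.range s) ≤ LinearMap.ker (LinearMap.toSpanSingleton R M m) :=
      Ideal.span_le.2 <| Set.range_subset_iff.2 fun i => by simpa [φ] using congrFun hm i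
    simpa using hle ha
  refine Submodule.eq_top_iff'.2 fun f => ?_
  obtain ⟨g, hg⟩ := hE.out φ hφ f
  have hf : f = ∑ i, s i • (g ∘ₗ LinearMap.single R (fun _ : Fin n => M) i) := by
    ext m
    rw [← hg m, ← LinearMap.sum_single_apply (fun _ : Fin n => M) (φ m), map_sum,
      LinearMap.sum_apply]
    refine Finset.sum_congr rfl fun i _ => ?_
    rw [LinearMap.smul_apply, LinearMap.comp_apply, LinearMap.single_apply, ← map_smul,
      ← Pi.single_smul]
    rfl
  rw [hf]
  exact Submodule.sum_mem _ fun i _ =>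
    Submodule.smul_mem_smul (Submodule.subset_span (Set.mem_range_self i)) Submodule.mem_top

theorem memF_iff_memFrakT_dual (hinj : Module.Injective R E)
    (hE : CategoryTheory.IsCoseparator (ModuleCat.of R E)) (hI : I.FG) :
    MemF I M ↔ MemFrakT I (M →ₗ[R] E) := by
  rw [memFrakT_iff, memF_iff]
  refine ⟨smul_top_dual_eq_top hinj hI, fun h m hm => ?_⟩
  have hle : I • (⊤ : Submodule R (M →ₗ[R] E)) ≤ LinearMap.ker (LinearMap.applyₗ m) := by
    rw [Submodule.smul_le]
    intro a ha f _
    rw [LinearMap.mem_ker, LinearMap.applyₗ_apply_apply, LinearMap.smul_apply, ← map_smul, hm a ha,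
      map_zero]
  rw [h] at hle
  exact eq_zero_of_forall_hom_eq_zero hE m fun f => hle Submodule.mem_top

end Duality

end ITorsion

theorem mainTheorem6 {R : Type u} [CommRing R] (I : Ideal R)
    (E : Type v) [AddCommGroup E] [Module R E]
    (hE_inj : Module.Injective R E)
    (hE_cogen : CategoryTheory.IsCoseparator (ModuleCat.of R E))
    (M : Type v) [AddCommGroup M] [Module R M]
    (hred : ITorsion.IsIReduced I M) (hcored : ITorsion.IsICoreduced I M) :
    (ITorsion.MemT I M ↔ ITorsion.MemT I (M →ₗ[R] E)) ∧
    (I.FG → (ITorsion.MemF I M ↔ ITorsion.MemFrakT I (M →ₗ[R] E))) ∧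
    (ITorsion.MemFrakT I M ↔ ITorsion.MemF I (M →ₗ[R] E)) :=
  ⟨ITorsion.memT_dual_iff I M hE_cogen,
    ITorsion.memF_iff_memFrakT_dual I M hE_inj hE_cogen,
    ITorsion.memFrakT_iff_memF_dual I M hE_cogen⟩
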